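/- Let $X$ be a real inner product space with $\dim X\ge 2$, let $Y$ be a real sequentially complete topological vector space, and let $r,s,t$ be positive integers. Let $B\subseteq X$ be an open ball containing $0$ and let $f:B\to Y$ satisfy $f(0)=0$. Suppose that $f$ is orthogonally generalized Jensen on $B$, that is, $$r\,f\!\left(\frac{sx+ty}{r}\right)=s\,f(x)+t\,f(y)$$ for all $x,y\in B$ with $\langle x,y\rangle=0$ and $\frac{sx+ty}{r}\in B$. Then there exist additive mappings $T:X\to Y$ and $b:[0,\infty)\to Y$ such that $$f(x)=T(x)+b\left(\|x\|^2\right)\qquad\text{for all }x\in B.$$ -/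

import Mathlib

open scoped NNReal Topology

/-- Sequential completeness of a topological vector space (or topological abelian group):
every Cauchy sequence converges. -/
def IsSequentiallyComplete (Y : Type*) [AddCommGroup Y] [TopologicalSpace Y] : Prop :=
  ∀ u : ℕ → Y,
    (∀ U ∈ 𝓝 (0 : Y), ∃ N : ℕ, ∀ m n : ℕ, N ≤ m → N ≤ n → u m - u n ∈ U) →
      ∃ y : Y, Filter.Tendsto u Filter.atTop (𝓝 y)

/-- `f : B → Y` is orthogonally generalized Jensen with parameters `r, s, t`:
`r f ((s x + t y) / r) = s f x + t f y` for all orthogonal `x, y ∈ B` for which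
`z = (s x + t y) / r` lies in the domain `B`. -/
def IsOrthogonallyGeneralizedJensen {X Y : Type*} [NormedAddCommGroup X] [InnerProductSpace ℝ X]
    [AddCommGroup Y] [Module ℝ Y] (r s t : ℕ) (B : Set X) (f : B → Y) : Prop :=
  ∀ x y z : B, inner ℝ (x : X) (y : X) = 0 →
    (z : X) = (r : ℝ)⁻¹ • ((s : ℝ) • (x : X) + (t : ℝ) • (y : X)) →
      (r : ℝ) • f z = (s : ℝ) • f x + (t : ℝ) • f y

/-! Setting one argument to zero makes `F` homogeneous for the ratios s/r and t/r, and substituting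
this back turns the Jensen equation into additivity on orthogonal pairs near 0. There the odd part
is additive, and the even part depends only on the norm and is additive in its square; doubling
extends both to global additive maps `T` and `b`.

It remains to reach all of the ball. If r = s = t, the difference between `F` and `T + b` is
orthogonally additive and zero near 0; small orthogonal projections carry this zero along each
segment from 0. Otherwise some ratio q ≠ 1 is available: homogeneity gives q·b, while b of a squared
norm scales by q², so `b` vanishes and scaling by q or 1/q spreads `F = T` outwards. -/

/-- A map that is additive on a star-shaped absorbing set `S` agrees on `S` with a globally
additive map. -/
theorem exists_addMonoidHom_eq_on_of_local_additive {M Y : Type*} [AddCommMonoid M] [Module ℝ≥0 M]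
    [AddCommGroup Y] [Module ℝ Y] (S : Set M)
    (hstar : ∀ a : ℝ≥0, a ≤ 1 → ∀ x ∈ S, a • x ∈ S)
    (habs : ∀ x : M, ∃ n : ℕ, ((2 : ℝ≥0)⁻¹ ^ n) • x ∈ S) (g : M → Y)
    (hg : ∀ x ∈ S, ∀ y ∈ S, x + y ∈ S → g (x + y) = g x + g y) :
    ∃ T : M →+ Y, ∀ x ∈ S, T x = g x := by
  have hhalf : (2 : ℝ≥0)⁻¹ ≤ 1 := inv_le_one_of_one_le₀ one_le_two
  have half : ∀ x ∈ S, (2 : ℝ) • g ((2 : ℝ≥0)⁻¹ • x) = g x := by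
    intro x hx
    have h1 := hstar _ hhalf x hx
    have h2 : (2 : ℝ≥0)⁻¹ • x + (2 : ℝ≥0)⁻¹ • x = x := by
      rw [← add_smul, ← two_mul, mul_inv_cancel₀ two_ne_zero, one_smul]
    have h3 := hg _ h1 _ h1 (by rwa [h2])
    rw [h2] at h3
    rw [two_smul, ← h3]
  have pow : ∀ (n : ℕ), ∀ x ∈ S, (2 : ℝ) ^ n • g (((2 : ℝ≥0)⁻¹ ^ n) • x) = g x := by
    intro n
    induction n with
    | zero => intro x _; simp
    | succ k ih =>
      intro x hx
      have h := half _ (hstar _ (pow_le_one₀ zero_le hhalf : (2 : ℝ≥0)⁻¹ ^ k ≤ 1) x hx)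
      rw [pow_succ, mul_smul, pow_succ', mul_smul, h, ih x hx]
  have mem_of_le : ∀ (x : M) (m n : ℕ), m ≤ n → ((2 : ℝ≥0)⁻¹ ^ m) • x ∈ S →
      ((2 : ℝ≥0)⁻¹ ^ n) • x ∈ S := by
    intro x m n hmn hm
    obtain ⟨k, rfl⟩ := Nat.exists_eq_add_of_le hmn
    rw [add_comm m k, pow_add, mul_smul]
    exact hstar _ (pow_le_one₀ zero_le hhalf) _ hm
  have indep : ∀ (x : M) (m n : ℕ), m ≤ n → ((2 : ℝ≥0)⁻¹ ^ m) • x ∈ S →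
      (2 : ℝ) ^ n • g (((2 : ℝ≥0)⁻¹ ^ n) • x) = (2 : ℝ) ^ m • g (((2 : ℝ≥0)⁻¹ ^ m) • x) := by
    intro x m n hmn hm
    obtain ⟨k, rfl⟩ := Nat.exists_eq_add_of_le hmn
    have h := pow k _ hm
    rw [smul_smul, ← pow_add, add_comm k m] at h
    rw [← h, smul_smul, ← pow_add]
  -- The extension is 2^n g(2^(-n) x), independent of n once 2^(-n) x lies in `S`; a common large n
  -- gives additivity.
  choose N hN using habs
  have key : ∀ (x : M) (n : ℕ), N x ≤ n → (2 : ℝ) ^ n • g (((2 : ℝ≥0)⁻¹ ^ n) • x) =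
      (2 : ℝ) ^ N x • g (((2 : ℝ≥0)⁻¹ ^ N x) • x) := fun x n h => indep x _ n h (hN x)
  have hT : ∀ x ∈ S, (2 : ℝ) ^ N x • g (((2 : ℝ≥0)⁻¹ ^ N x) • x) = g x := fun x hx => pow _ x hx
  have hadd : ∀ x y, (2 : ℝ) ^ N (x + y) • g (((2 : ℝ≥0)⁻¹ ^ N (x + y)) • (x + y)) =
      (2 : ℝ) ^ N x • g (((2 : ℝ≥0)⁻¹ ^ N x) • x) +
        (2 : ℝ) ^ N y • g (((2 : ℝ≥0)⁻¹ ^ N y) • y) := by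
    intro x y
    have hx : N x ≤ N x + N y + N (x + y) := by omega
    have hy : N y ≤ N x + N y + N (x + y) := by omega
    have hxy : N (x + y) ≤ N x + N y + N (x + y) := by omega
    have h := mem_of_le _ _ _ hxy (hN (x + y))
    rw [← key _ _ hx, ← key _ _ hy, ← key _ _ hxy, ← smul_add]
    congr 1
    rw [smul_add] at h ⊢
    exact hg _ (mem_of_le _ _ _ hx (hN x)) _ (mem_of_le _ _ _ hy (hN y)) h
  refine ⟨⟨⟨fun x => (2 : ℝ) ^ N x • g (((2 : ℝ≥0)⁻¹ ^ N x) • x), ?_⟩, hadd⟩, hT⟩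
  have h := hadd 0 0
  simpa using h

/-! ### Orthogonal additivity near the origin -/

section OrthogonallyAdditive

variable {X Y : Type*} [NormedAddCommGroup X] [InnerProductSpace ℝ X] [AddCommGroup Y]

/-- In dimension at least two, every vector has an orthogonal vector of any prescribed norm. -/
theorem exists_orthogonal_norm_eq (hdim : 2 ≤ Module.rank ℝ X) (x : X) (a : ℝ) (ha : 0 ≤ a) :
    ∃ w : X, inner ℝ x w = 0 ∧ ‖w‖ = a := by
  obtain ⟨w, hw, hw0⟩ : ∃ w : X, inner ℝ x w = 0 ∧ w ≠ 0 := by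
    by_contra! h
    have hbot : (ℝ ∙ x)ᗮ = ⊥ := by
      rw [Submodule.eq_bot_iff]
      intro w hw
      exact h w ((Submodule.mem_orthogonal_singleton_iff_inner_right).1 hw)
    have htop : (ℝ ∙ x) = ⊤ := (Submodule.orthogonal_eq_bot_iff).1 hbot
    have h1 : Module.rank ℝ (ℝ ∙ x) ≤ 1 := by
      simpa using rank_span_le (R := ℝ) ({x} : Set X)
    rw [htop, rank_top] at h1
    exact absurd (hdim.trans h1) (by norm_num)
  refine ⟨(a / ‖w‖) • w, by rw [inner_smul_right, hw, mul_zero], ?_⟩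
  have : ‖w‖ ≠ 0 := norm_ne_zero_iff.2 hw0
  rw [norm_smul, Real.norm_of_nonneg (by positivity), div_mul_cancel₀ _ this]

theorem norm_add_sq_of_inner_eq_zero {x y : X} (h : inner ℝ x y = 0) :
    ‖x + y‖ ^ 2 = ‖x‖ ^ 2 + ‖y‖ ^ 2 := by
  rw [norm_add_sq_real, h]; ring

theorem norm_le_norm_add_of_inner_eq_zero {x y : X} (h : inner ℝ x y = 0) :
    ‖x‖ ≤ ‖x + y‖ := by
  have := norm_add_sq_of_inner_eq_zero h
  exact abs_le_of_sq_le_sq' (by nlinarith [sq_nonneg ‖y‖]) (norm_nonneg _) |>.2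

/-- Orthogonal additivity on the ball of radius `ρ` around the origin. -/
def IsOrthogonallyAdditiveBelow (ρ : ℝ) (F : X → Y) : Prop :=
  ∀ x y : X, inner ℝ x y = 0 → ‖x + y‖ < ρ → F (x + y) = F x + F y

/-- Splitting y along x and its orthogonal complement reduces the claim to additivity on a line. -/
theorem IsOrthogonallyAdditiveBelow.add_of_odd (hdim : 2 ≤ Module.rank ℝ X) {ρ : ℝ} {F : X → Y}
    (hF : IsOrthogonallyAdditiveBelow ρ F) (hodd : ∀ x, F (-x) = -F x) {x y : X}
    (hx : ‖x‖ < ρ) (hy : ‖y‖ < ρ) (hxy : ‖x + y‖ < ρ) : F (x + y) = F x + F y := by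
  -- additivity along a ray
  have ray : ∀ (v : X) (a b : ℝ), 0 ≤ a → 0 ≤ b → ‖(a + b) • v‖ < ρ →
      F ((a + b) • v) = F (a • v) + F (b • v) := by
    intro v a b ha hb hv
    -- With ‖w‖² = ab‖v‖² the vectors av + w and bv - w are orthogonal, and oddness cancels the two
    -- contributions of w.
    obtain ⟨w, hvw, hw⟩ := exists_orthogonal_norm_eq hdim v (√(a * b) * ‖v‖) (by positivity)
    have hwsq : ‖w‖ ^ 2 = a * b * ‖v‖ ^ 2 := by
      rw [hw, mul_pow, Real.sq_sqrt (mul_nonneg ha hb)]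
    have hwv : inner ℝ w v = 0 := by rw [real_inner_comm, hvw]
    have hsum : (a • v + w) + (b • v + -w) = (a + b) • v := by rw [add_smul]; abel
    have horth : inner ℝ (a • v + w) (b • v + -w) = 0 := by
      simp only [inner_add_left, inner_add_right, inner_neg_right, real_inner_smul_left,
        real_inner_smul_right, hvw, hwv, real_inner_self_eq_norm_sq, hwsq]
      ring
    have h1 : ‖a • v + w‖ < ρ := by
      have := norm_le_norm_add_of_inner_eq_zero horth
      rw [hsum] at this
      exact this.trans_lt hv
    have h2 : ‖b • v + -w‖ < ρ := by
      rw [real_inner_comm] at horth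
      have := norm_le_norm_add_of_inner_eq_zero horth
      rw [add_comm (b • v + -w), hsum] at this
      exact this.trans_lt hv
    have e1 := hF _ _ horth (by rwa [hsum])
    rw [hsum] at e1
    rw [e1, hF _ _ (by rw [real_inner_smul_left, hvw, mul_zero]) h1,
      hF _ _ (by rw [inner_neg_right, real_inner_smul_left, hvw]; simp) h2, hodd]
    abel
  have line : ∀ (v : X) (a b : ℝ), ‖a • v‖ < ρ → ‖b • v‖ < ρ → ‖(a + b) • v‖ < ρ →
      F ((a + b) • v) = F (a • v) + F (b • v) := by
    intro v
    have hneg : ∀ a : ℝ, F ((-a) • v) = -F (a • v) := fun a => by rw [neg_smul, hodd]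
    have hnorm : ∀ a : ℝ, ‖(-a) • v‖ = ‖a • v‖ := fun a => by rw [neg_smul, norm_neg]
    have mixed : ∀ a b : ℝ, 0 ≤ a → b ≤ 0 → ‖a • v‖ < ρ → ‖b • v‖ < ρ →
        F ((a + b) • v) = F (a • v) + F (b • v) := by
      intro a b ha hb hav hbv
      rcases le_total 0 (a + b) with h | h
      · have e := ray v (a + b) (-b) h (by linarith) (by rwa [add_neg_cancel_right])
        rw [add_neg_cancel_right, hneg] at e
        rw [e]; abel
      · have hs : a + -(a + b) = -b := by ring
        have e := ray v a (-(a + b)) ha (by linarith) (by rwa [hs, hnorm])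
        rw [hs, hneg, hneg] at e
        rw [eq_comm, ← sub_eq_add_neg, sub_eq_iff_eq_add] at e
        rw [e]; abel
    intro a b hav hbv habv
    rcases le_total 0 a with ha | ha <;> rcases le_total 0 b with hb | hb
    · exact ray v a b ha hb habv
    · exact mixed a b ha hb hav hbv
    · rw [add_comm a b, mixed b a hb ha hbv hav, add_comm]
    · have hs : -a + -b = -(a + b) := by ring
      have e := ray v (-a) (-b) (by linarith) (by linarith) (by rwa [hs, hnorm])
      rw [hs, hneg, hneg, hneg, ← neg_add, neg_inj] at e
      exact e
  obtain ⟨l, z, hz, rfl⟩ : ∃ (l : ℝ) (z : X), inner ℝ x z = 0 ∧ y = l • x + z := by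
    refine ⟨inner ℝ x y / ‖x‖ ^ 2, y - (inner ℝ x y / ‖x‖ ^ 2) • x, ?_, by abel⟩
    rw [inner_sub_right, real_inner_smul_right, real_inner_self_eq_norm_sq]
    rcases eq_or_ne x 0 with rfl | h
    · simp
    · have : ‖x‖ ≠ 0 := norm_ne_zero_iff.2 h
      field_simp
      ring
  have hl : inner ℝ (l • x) z = 0 := by rw [real_inner_smul_left, hz, mul_zero]
  have hl' : inner ℝ ((1 + l) • x) z = 0 := by rw [real_inner_smul_left, hz, mul_zero]
  have hs : x + (l • x + z) = (1 + l) • x + z := by rw [add_smul, one_smul, add_assoc]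
  rw [hs] at hxy ⊢
  have e := line x 1 l (by rwa [one_smul])
    ((norm_le_norm_add_of_inner_eq_zero hl).trans_lt hy)
    ((norm_le_norm_add_of_inner_eq_zero hl').trans_lt hxy)
  rw [hF _ _ hl' hxy, hF _ _ hl hy, e, one_smul, add_assoc]

/-- Equal norms make (x + y)/2 and (x - y)/2 orthogonal; their sum is x and their difference y, and
evenness ignores the sign. -/
theorem IsOrthogonallyAdditiveBelow.eq_of_even_of_norm_eq {ρ : ℝ} {F : X → Y}
    (hF : IsOrthogonallyAdditiveBelow ρ F) (heven : ∀ x, F (-x) = F x) {x y : X}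
    (hx : ‖x‖ < ρ) (hxy : ‖x‖ = ‖y‖) : F x = F y := by
  have horth : inner ℝ ((2 : ℝ)⁻¹ • (x + y)) ((2 : ℝ)⁻¹ • (x - y)) = 0 := by
    rw [real_inner_smul_left, real_inner_smul_right,
      (real_inner_add_sub_eq_zero_iff x y).2 hxy, mul_zero, mul_zero]
  have e1 : (2 : ℝ)⁻¹ • (x + y) + (2 : ℝ)⁻¹ • (x - y) = x := by module
  have e2 : (2 : ℝ)⁻¹ • (x + y) + -((2 : ℝ)⁻¹ • (x - y)) = y := by module
  have h1 := hF _ _ horth (by rwa [e1])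
  have h2 := hF _ (-((2 : ℝ)⁻¹ • (x - y))) (by rw [inner_neg_right, horth, neg_zero])
    (by rwa [e2, ← hxy])
  rw [e1] at h1
  rw [e2, heven] at h2
  rw [h1, h2]

theorem IsOrthogonallyAdditiveBelow.comp_neg {ρ : ℝ} {F : X → Y}
    (hF : IsOrthogonallyAdditiveBelow ρ F) :
    IsOrthogonallyAdditiveBelow ρ (fun x => F (-x)) := by
  intro x y h hxy
  have e := hF (-x) (-y) (by rw [inner_neg_neg, h]) (by rwa [← neg_add, norm_neg])
  rwa [← neg_add] at e

/-! ### Propagation from the origin -/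

/-- Propagation of a property from a neighbourhood of the origin along contractions. -/
theorem forall_mem_of_contraction {S : Set X} {P : X → Prop} {ρ a : ℝ} (hρ : 0 < ρ)
    (ha0 : 0 ≤ a) (ha1 : a < 1) (hS : ∀ x ∈ S, a • x ∈ S) (hP : ∀ x ∈ S, ‖x‖ < ρ → P x)
    (hstep : ∀ x ∈ S, P (a • x) → P x) : ∀ x ∈ S, P x := by
  have h : ∀ (n : ℕ), ∀ x ∈ S, a ^ n * ‖x‖ < ρ → P x := by
    intro n
    induction n with
    | zero => intro x hx h; exact hP x hx (by simpa using h)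
    | succ k ih =>
      intro x hx h
      refine hstep x hx (ih _ (hS x hx) ?_)
      rwa [norm_smul, Real.norm_of_nonneg ha0, ← mul_assoc, ← pow_succ]
  intro x hx
  obtain ⟨n, hn⟩ := exists_pow_lt_of_lt_one (div_pos hρ (by positivity : 0 < ‖x‖ + 1)) ha1
  refine h n x hx ?_
  rw [lt_div_iff₀ (by positivity)] at hn
  have : (0 : ℝ) ≤ a ^ n := by positivity
  linarith

/-- An orthogonally additive map on an open convex set that vanishes near the origin vanishes. -/
theorem eq_zero_of_orthogonallyAdditive (hdim : 2 ≤ Module.rank ℝ X) {B : Set X}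
    (hopen : IsOpen B) (hconv : Convex ℝ B) {ρ : ℝ} (hρ : 0 < ρ)
    (hρB : ∀ x, ‖x‖ < ρ → x ∈ B) {G : X → Y}
    (hG : ∀ x ∈ B, ∀ y ∈ B, inner ℝ x y = 0 → x + y ∈ B → G (x + y) = G x + G y)
    (hG0 : ∀ x, ‖x‖ < ρ → G x = 0) : ∀ x ∈ B, G x = 0 := by
  intro x hx
  obtain ⟨δ, hδ, hδB⟩ := Metric.isOpen_iff.1 hopen x hx
  obtain ⟨ε, hε, hερ, hεδ⟩ : ∃ ε : ℝ, 0 < ε ∧ ε ≤ ρ ∧ ε ≤ δ :=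
    ⟨min ρ δ, lt_min hρ hδ, min_le_left _ _, min_le_right _ _⟩
  -- A tube of uniform width around the segment from 0 to x: kx + u = k(x + u) + (1 - k)u.
  have margin : ∀ k : ℝ, 0 ≤ k → k ≤ 1 → ∀ u : X, ‖u‖ < ε → k • x + u ∈ B := by
    intro k hk0 hk1 u hu
    have h1 : x + u ∈ B := hδB (by rw [Metric.mem_ball, dist_eq_norm]; simpa using hu.trans_le hεδ)
    have h2 := hconv h1 (hρB u (hu.trans_le hερ)) hk0 (sub_nonneg.2 hk1) (by ring)
    convert h2 using 1
    module
  -- `k • x` is projected to a nearby line and back, which scales it by `(1 + θ ^ 2)⁻¹`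
  obtain ⟨θ, hθ0, hθ⟩ : ∃ θ : ℝ, 0 < θ ∧ θ * ‖x‖ < ε := by
    refine ⟨ε / (‖x‖ + 1), by positivity, ?_⟩
    rw [div_mul_eq_mul_div, div_lt_iff₀ (by positivity)]
    nlinarith
  obtain ⟨w, hw, hwn⟩ := exists_orthogonal_norm_eq hdim x ‖x‖ (norm_nonneg _)
  have hwx : inner ℝ w x = 0 := by rw [real_inner_comm, hw]
  have hpos : 0 < 1 + θ ^ 2 := by positivity
  set a : ℝ := (1 + θ ^ 2)⁻¹ with ha
  have ha0 : 0 < a := inv_pos.2 hpos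
  have ha1 : a < 1 := inv_lt_one_of_one_lt₀ (by nlinarith)
  have haθ : a * (1 + θ ^ 2) = 1 := inv_mul_cancel₀ hpos.ne'
  have step : ∀ k : ℝ, 0 ≤ k → k ≤ 1 → G (k • x) = G ((a * k) • x) := by
    intro k hk0 hk1
    have hak : a * k ≤ 1 := by nlinarith
    have hakk : a * k * θ ≤ θ := by nlinarith
    have hu2n : ‖(a * k * θ) • w‖ < ε := by
      rw [norm_smul, Real.norm_of_nonneg (by positivity), hwn]
      exact (mul_le_mul_of_nonneg_right hakk (norm_nonneg _)).trans_lt hθ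
    -- This is the part of kx orthogonal to x + θw. Like the part removed on projecting back, it is
    -- short enough for `G` to vanish on it.
    have hu1n : ‖(a * k * θ) • (θ • x - w)‖ < ε := by
      have hsq : ‖(a * k * θ) • (θ • x - w)‖ ^ 2 ≤ (θ * ‖x‖) ^ 2 := by
        rw [norm_smul, Real.norm_of_nonneg (by positivity), mul_pow, norm_sub_sq_real,
          real_inner_smul_left, hw, norm_smul, Real.norm_of_nonneg hθ0.le, hwn]
        have : (a * k * θ) ^ 2 * ((θ * ‖x‖) ^ 2 - 2 * (θ * 0) + ‖x‖ ^ 2) =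
          (k ^ 2 * a * (a * (1 + θ ^ 2))) * (θ * ‖x‖) ^ 2 := by ring
        rw [this, haθ, mul_one]
        refine mul_le_of_le_one_left (by positivity) ?_
        exact mul_le_one₀ (pow_le_one₀ hk0 hk1) ha0.le ha1.le
      exact ((abs_le_of_sq_le_sq' hsq (by positivity)).2).trans_lt hθ
    have hv : (a * k) • x + (a * k * θ) • w ∈ B := margin _ (by positivity) hak _ hu2n
    have hsum1 : ((a * k) • x + (a * k * θ) • w) + (a * k * θ) • (θ • x - w) = k • x := by
      have : (a * k) • x + (a * k * θ) • w + (a * k * θ) • (θ • x - w) =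
        (k * (a * (1 + θ ^ 2))) • x := by module
      rw [this, haθ, mul_one]
    have horth1 : inner ℝ ((a * k) • x + (a * k * θ) • w) ((a * k * θ) • (θ • x - w)) = 0 := by
      simp only [inner_add_left, inner_sub_right, real_inner_smul_left, real_inner_smul_right,
        hw, hwx, real_inner_self_eq_norm_sq, hwn]
      ring
    have hkx : k • x ∈ B := by simpa using margin k hk0 hk1 0 (by simpa using hε)
    have hakx : (a * k) • x ∈ B := by
      simpa using margin (a * k) (by positivity) hak 0 (by simpa using hε)
    have e1 := hG _ hv _ (hρB _ (hu1n.trans_le hερ)) horth1 (by rwa [hsum1])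
    have e2 := hG _ hakx _ (hρB _ (hu2n.trans_le hερ))
      (by rw [real_inner_smul_left, real_inner_smul_right, hw, mul_zero, mul_zero]) hv
    rw [hsum1, hG0 _ (hu1n.trans_le hερ), add_zero, e2, hG0 _ (hu2n.trans_le hερ), add_zero] at e1
    exact e1
  refine forall_mem_of_contraction (S := {y | ∃ k : ℝ, 0 ≤ k ∧ k ≤ 1 ∧ y = k • x})
    (P := fun y => G y = 0) hρ ha0.le ha1 ?_ (fun y _ hy => hG0 y hy) ?_ x
    ⟨1, zero_le_one, le_rfl, (one_smul _ _).symm⟩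
  · rintro y ⟨k, hk0, hk1, rfl⟩
    exact ⟨a * k, by positivity, by nlinarith, by rw [smul_smul]⟩
  · rintro y ⟨k, hk0, hk1, rfl⟩ h
    rw [step k hk0 hk1, ← smul_smul]
    exact h

/-! ### Local representation by additive maps -/

variable [Module ℝ Y]

/-- An odd map orthogonally additive near the origin is the restriction of an additive map. -/
theorem IsOrthogonallyAdditiveBelow.exists_addMonoidHom_of_odd (hdim : 2 ≤ Module.rank ℝ X)
    {ρ : ℝ} (hρ : 0 < ρ) {F : X → Y} (hF : IsOrthogonallyAdditiveBelow ρ F)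
    (hodd : ∀ x, F (-x) = -F x) : ∃ T : X →+ Y, ∀ x, ‖x‖ < ρ → T x = F x := by
  refine exists_addMonoidHom_eq_on_of_local_additive {x : X | ‖x‖ < ρ} ?_ ?_ F
    (fun x hx y hy hxy => hF.add_of_odd hdim hodd hx hy hxy)
  · intro a ha x hx
    have ha' : (a : ℝ) ≤ 1 := by exact_mod_cast ha
    have : ‖a • x‖ = a * ‖x‖ := by
      rw [NNReal.smul_def, norm_smul, Real.norm_of_nonneg a.coe_nonneg]
    rw [Set.mem_ofPred_eq, this]
    exact (mul_le_of_le_one_left (norm_nonneg _) ha').trans_lt hx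
  · intro x
    obtain ⟨n, hn⟩ := exists_pow_lt_of_lt_one (div_pos hρ (by positivity : 0 < ‖x‖ + 1))
      (by norm_num : (2 : ℝ)⁻¹ < 1)
    refine ⟨n, ?_⟩
    rw [lt_div_iff₀ (by positivity)] at hn
    have : ‖((2 : ℝ≥0)⁻¹ ^ n) • x‖ = (2 : ℝ)⁻¹ ^ n * ‖x‖ := by
      rw [NNReal.smul_def, norm_smul, Real.norm_of_nonneg (NNReal.coe_nonneg _)]
      push_cast
      rfl
    rw [Set.mem_ofPred_eq, this]
    have : (0 : ℝ) < 2⁻¹ ^ n := by positivity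
    nlinarith

/-- An even map orthogonally additive near the origin is there an additive function of the
squared norm. -/
theorem IsOrthogonallyAdditiveBelow.exists_addMonoidHom_of_even (hdim : 2 ≤ Module.rank ℝ X)
    {ρ : ℝ} (hρ : 0 < ρ) {F : X → Y} (hF : IsOrthogonallyAdditiveBelow ρ F)
    (heven : ∀ x, F (-x) = F x) : ∃ b : ℝ≥0 →+ Y, ∀ x, ‖x‖ < ρ → b (‖x‖₊ ^ 2) = F x := by
  obtain ⟨e, -, he⟩ := exists_orthogonal_norm_eq hdim (0 : X) 1 zero_le_one
  have hnorm : ∀ q : ℝ≥0, ‖√(q : ℝ) • e‖ = √q := fun q => by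
    rw [norm_smul, he, mul_one, Real.norm_of_nonneg (Real.sqrt_nonneg _)]
  have hlt : ∀ q : ℝ≥0, (q : ℝ) < ρ ^ 2 → √(q : ℝ) < ρ := fun q hq =>
    (Real.sqrt_lt' hρ).2 hq
  have hstar : ∀ a : ℝ≥0, a ≤ 1 → ∀ q ∈ {q : ℝ≥0 | (q : ℝ) < ρ ^ 2},
      a • q ∈ {q : ℝ≥0 | (q : ℝ) < ρ ^ 2} := by
    intro a ha q hq
    have ha' : (a : ℝ) ≤ 1 := by exact_mod_cast ha
    rw [Set.mem_ofPred_eq, smul_eq_mul, NNReal.coe_mul]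
    exact (mul_le_of_le_one_left q.2 ha').trans_lt hq
  have habs : ∀ q : ℝ≥0, ∃ n : ℕ, ((2 : ℝ≥0)⁻¹ ^ n) • q ∈ {q : ℝ≥0 | (q : ℝ) < ρ ^ 2} := by
    intro q
    obtain ⟨n, hn⟩ := exists_pow_lt_of_lt_one
      (div_pos (pow_pos hρ 2) (by positivity : 0 < (q : ℝ) + 1)) (by norm_num : (2 : ℝ)⁻¹ < 1)
    refine ⟨n, ?_⟩
    rw [lt_div_iff₀ (by positivity)] at hn
    rw [Set.mem_ofPred_eq, smul_eq_mul]
    push_cast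
    have : (0 : ℝ) < 2⁻¹ ^ n := by positivity
    linarith
  obtain ⟨b, hb⟩ := exists_addMonoidHom_eq_on_of_local_additive _ hstar habs
    (fun q => F (√(q : ℝ) • e)) (by
      intro p hp q hq hpq
      -- Replacing the second multiple of `e` by an orthogonal vector of the same norm lets
      -- Pythagoras add the squared norms.
      obtain ⟨w, hw, hwn⟩ := exists_orthogonal_norm_eq hdim e (√(q : ℝ)) (Real.sqrt_nonneg _)
      have horth : inner ℝ (√(p : ℝ) • e) w = 0 := by rw [real_inner_smul_left, hw, mul_zero]
      have hsum : ‖√(((p + q : ℝ≥0)) : ℝ) • e‖ = ‖√(p : ℝ) • e + w‖ := by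
        rw [hnorm, ← Real.sqrt_sq (norm_nonneg (√(p : ℝ) • e + w)),
          norm_add_sq_of_inner_eq_zero horth, hnorm, hwn, Real.sq_sqrt p.coe_nonneg,
          Real.sq_sqrt q.coe_nonneg, NNReal.coe_add]
      have hs : ‖√(((p + q : ℝ≥0)) : ℝ) • e‖ < ρ := by rw [hnorm]; exact hlt _ hpq
      have hwq : F w = F (√(q : ℝ) • e) :=
        hF.eq_of_even_of_norm_eq heven (by rw [hwn]; exact hlt q hq) (by rw [hwn, hnorm])
      show F (√(((p + q : ℝ≥0)) : ℝ) • e) = F (√(p : ℝ) • e) + F (√(q : ℝ) • e)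
      rw [hF.eq_of_even_of_norm_eq heven hs hsum, hF _ _ horth (by rwa [← hsum]), hwq])
  refine ⟨b, fun x hx => ?_⟩
  have hsq : ((‖x‖₊ ^ 2 : ℝ≥0) : ℝ) = ‖x‖ ^ 2 := by push_cast; rfl
  rw [hb _ (by rw [Set.mem_ofPred_eq, hsq]; gcongr)]
  refine (hF.eq_of_even_of_norm_eq heven hx ?_).symm
  rw [hnorm, hsq, Real.sqrt_sq (norm_nonneg _)]

/-- A map orthogonally additive near the origin is there the sum of an additive map and an
additive function of the squared norm. -/
theorem IsOrthogonallyAdditiveBelow.exists_addMonoidHom (hdim : 2 ≤ Module.rank ℝ X)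
    {ρ : ℝ} (hρ : 0 < ρ) {F : X → Y} (hF : IsOrthogonallyAdditiveBelow ρ F) :
    ∃ (T : X →+ Y) (b : ℝ≥0 →+ Y), ∀ x, ‖x‖ < ρ → F x = T x + b (‖x‖₊ ^ 2) := by
  have hneg := hF.comp_neg
  -- The odd and even parts of `F` inherit orthogonal additivity.
  obtain ⟨T, hT⟩ := IsOrthogonallyAdditiveBelow.exists_addMonoidHom_of_odd hdim hρ
    (F := fun x => (2 : ℝ)⁻¹ • (F x - F (-x)))
    (fun x y h hxy => by
      have h1 := hF x y h hxy
      have h2 := hneg x y h hxy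
      simp only at h2 ⊢
      rw [h1, h2]; module)
    (fun x => by simp only [neg_neg]; module)
  obtain ⟨b, hb⟩ := IsOrthogonallyAdditiveBelow.exists_addMonoidHom_of_even hdim hρ
    (F := fun x => (2 : ℝ)⁻¹ • (F x + F (-x)))
    (fun x y h hxy => by
      have h1 := hF x y h hxy
      have h2 := hneg x y h hxy
      simp only at h2 ⊢
      rw [h1, h2]; module)
    (fun x => by simp only [neg_neg]; module)
  refine ⟨T, b, fun x hx => ?_⟩
  rw [hT x hx, hb x hx]
  module

/-! ### Rational homogeneity -/

theorem AddMonoidHom.map_div_natCast_smul {M : Type*} [AddCommGroup M] [Module ℝ M]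
    (T : M →+ Y) (m n : ℕ) (x : M) :
    T (((m : ℝ) / n) • x) = ((m : ℝ) / n) • T x := by
  simpa using map_ratCast_smul T ℝ ℝ ((m : ℚ) / n) x

theorem AddMonoidHom.map_nnreal_div_natCast_mul (b : ℝ≥0 →+ Y) (m : ℕ) {n : ℕ} (hn : 0 < n)
    (q : ℝ≥0) : b (((m : ℝ≥0) / n) * q) = ((m : ℝ) / n) • b q := by
  have hn' : (n : ℝ) ≠ 0 := by positivity
  have hn'' : (n : ℝ≥0) ≠ 0 := by positivity
  have h : n • b (((m : ℝ≥0) / n) * q) = m • b q := by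
    rw [← map_nsmul, ← map_nsmul, nsmul_eq_mul, nsmul_eq_mul, ← mul_assoc, mul_div_cancel₀ _ hn'']
  rw [← Nat.cast_smul_eq_nsmul ℝ, ← Nat.cast_smul_eq_nsmul ℝ] at h
  rw [div_eq_inv_mul (m : ℝ), mul_smul, ← h, smul_smul, inv_mul_cancel₀ hn', one_smul]

/-- If a map of the form `T x + b (‖x‖ ^ 2)` near the origin is homogeneous for a ratio
`m / n ≠ 1` on a convex set, then it equals `T` there. -/
theorem eq_addMonoidHom_of_homogeneous {B : Set X} (hconv : Convex ℝ B) {ρ : ℝ} (hρ : 0 < ρ)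
    (hρB : ∀ x, ‖x‖ < ρ → x ∈ B) {F : X → Y} {T : X →+ Y} {b : ℝ≥0 →+ Y}
    (hF : ∀ x, ‖x‖ < ρ → F x = T x + b (‖x‖₊ ^ 2)) {m n : ℕ} (hm : 0 < m) (hn : 0 < n)
    (hmn : m ≠ n)
    (hhom : ∀ x ∈ B, ((m : ℝ) / n) • x ∈ B → F (((m : ℝ) / n) • x) = ((m : ℝ) / n) • F x) :
    ∀ x ∈ B, F x = T x := by
  have hm' : (0 : ℝ) < m := by exact_mod_cast hm
  have hn' : (0 : ℝ) < n := by exact_mod_cast hn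
  have h0B : (0 : X) ∈ B := hρB 0 (by simpa using hρ)
  set a : ℝ := (m : ℝ) / n with ha
  have ha0 : 0 < a := by positivity
  have ha1 : a ≠ 1 := by
    rw [ha, Ne, div_eq_one_iff_eq hn'.ne']; exact_mod_cast hmn
  have hTa : ∀ x, T (a • x) = a • T x := fun x => T.map_div_natCast_smul m n x
  -- Below `σ`, both x and ax lie where the local formula holds.
  obtain ⟨σ, hσ, hσρ, hσa⟩ : ∃ σ : ℝ, 0 < σ ∧ σ ≤ ρ ∧ a * σ ≤ ρ := by
    refine ⟨min ρ (ρ / a), lt_min hρ (by positivity), min_le_left _ _, ?_⟩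
    calc a * min ρ (ρ / a) ≤ a * (ρ / a) := by gcongr; exact min_le_right _ _
      _ = ρ := by field_simp
  have near : ∀ x, ‖x‖ < σ → F x = T x := by
    intro x hx
    have hxρ := hx.trans_le hσρ
    have haxn : ‖a • x‖ < ρ := by
      rw [norm_smul, Real.norm_of_nonneg ha0.le]
      exact (mul_lt_mul_of_pos_left hx ha0).trans_le hσa
    have e := hhom x (hρB x hxρ) (hρB _ haxn)
    -- The squared norm scales by a², so comparison with homogeneity of degree one leaves (a - 1)
    -- b(‖x‖²) = 0.
    have hq : ‖a • x‖₊ ^ 2 = ((m : ℝ≥0) / n) * (((m : ℝ≥0) / n) * ‖x‖₊ ^ 2) := by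
      apply NNReal.coe_injective
      push_cast
      rw [norm_smul, Real.norm_of_nonneg ha0.le, ha]
      ring
    rw [hF _ haxn, hF _ hxρ, hTa, smul_add, hq, b.map_nnreal_div_natCast_mul m hn,
      b.map_nnreal_div_natCast_mul m hn, ← ha, add_right_inj] at e
    have e' := smul_right_injective Y ha0.ne' e
    have hz : (a - 1) • b (‖x‖₊ ^ 2) = 0 := by
      rw [sub_smul, e', one_smul, sub_self]
    rw [hF x hxρ, (smul_eq_zero.1 hz).resolve_left (sub_ne_zero.2 ha1), add_zero]
  have contract : ∀ k : ℝ, 0 ≤ k → k ≤ 1 → ∀ x ∈ B, k • x ∈ B := fun k h0 h1 x hx =>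
    hconv.smul_mem_of_zero_mem h0B hx ⟨h0, h1⟩
  rcases lt_or_gt_of_ne ha1 with h | h
  · refine forall_mem_of_contraction hσ ha0.le h (contract a ha0.le h.le)
      (fun x _ => near x) ?_
    intro x hx e
    rw [hhom x hx (contract a ha0.le h.le x hx), hTa] at e
    exact smul_right_injective Y ha0.ne' e
  · have hi1 : a⁻¹ < 1 := inv_lt_one_of_one_lt₀ h
    have hi0 : 0 ≤ a⁻¹ := by positivity
    refine forall_mem_of_contraction hσ hi0 hi1 (contract _ hi0 hi1.le) (fun x _ => near x) ?_
    intro x hx e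
    have hax : a • a⁻¹ • x = x := smul_inv_smul₀ ha0.ne' x
    have e' := hhom (a⁻¹ • x) (contract _ hi0 hi1.le x hx) (by rwa [hax])
    rw [e, ← hTa, hax] at e'
    exact e'

end OrthogonallyAdditive

/-! ### The Jensen equation on the ball -/

theorem theorem6p1 {X Y : Type*} [NormedAddCommGroup X] [InnerProductSpace ℝ X]
    (hdim : 2 ≤ Module.rank ℝ X)
    [AddCommGroup Y] [Module ℝ Y] [TopologicalSpace Y] [IsTopologicalAddGroup Y]
    [ContinuousSMul ℝ Y] (hY : IsSequentiallyComplete Y)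
    (r s t : ℕ) (hr : 0 < r) (hs : 0 < s) (ht : 0 < t)
    (c : X) (R : ℝ) (h0 : (0 : X) ∈ Metric.ball c R)
    (f : Metric.ball c R → Y) (hf0 : f ⟨0, h0⟩ = 0)
    (hf : IsOrthogonallyGeneralizedJensen r s t (Metric.ball c R) f) :
    ∃ (T : X →+ Y) (b : ℝ≥0 →+ Y),
      ∀ x : Metric.ball c R, f x = T (x : X) + b (‖(x : X)‖₊ ^ 2) := by
  classical
  have hopen : IsOpen (Metric.ball c R) := Metric.isOpen_ball
  have hconv : Convex ℝ (Metric.ball c R) := convex_ball c R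
  generalize Metric.ball c R = B at *
  obtain ⟨F, hFf⟩ : ∃ F : X → Y, ∀ x : B, F x = f x :=
    ⟨fun x => if h : x ∈ B then f ⟨x, h⟩ else 0, fun x => by simp⟩
  have hr' : (0 : ℝ) < r := by exact_mod_cast hr
  have hs' : (0 : ℝ) < s := by exact_mod_cast hs
  have ht' : (0 : ℝ) < t := by exact_mod_cast ht
  have hF0 : F 0 = 0 := by rw [← hf0]; exact hFf ⟨0, h0⟩
  have jensen : ∀ x ∈ B, ∀ y ∈ B, inner ℝ x y = 0 →
      ((s : ℝ) / r) • x + ((t : ℝ) / r) • y ∈ B →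
      F (((s : ℝ) / r) • x + ((t : ℝ) / r) • y) = ((s : ℝ) / r) • F x + ((t : ℝ) / r) • F y := by
    intro x hx y hy hxy hz
    have e := hf ⟨x, hx⟩ ⟨y, hy⟩ ⟨_, hz⟩ hxy (by simp only; module)
    rw [← hFf, ← hFf, ← hFf] at e
    apply smul_right_injective Y hr'.ne'
    simp only at e ⊢
    rw [e, smul_add, smul_smul, smul_smul, mul_div_cancel₀ _ hr'.ne', mul_div_cancel₀ _ hr'.ne']
  have homs : ∀ x ∈ B, ((s : ℝ) / r) • x ∈ B → F (((s : ℝ) / r) • x) = ((s : ℝ) / r) • F x := by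
    intro x hx h
    simpa [hF0] using jensen x hx 0 h0 (inner_zero_right _) (by simpa using h)
  have homt : ∀ x ∈ B, ((t : ℝ) / r) • x ∈ B → F (((t : ℝ) / r) • x) = ((t : ℝ) / r) • F x := by
    intro x hx h
    simpa [hF0] using jensen 0 h0 x hx (inner_zero_left _) (by simpa using h)
  have additive : ∀ x ∈ B, ∀ y ∈ B, ((s : ℝ) / r) • x ∈ B → ((t : ℝ) / r) • y ∈ B →
      inner ℝ x y = 0 → ((s : ℝ) / r) • x + ((t : ℝ) / r) • y ∈ B →
      F (((s : ℝ) / r) • x + ((t : ℝ) / r) • y) =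
        F (((s : ℝ) / r) • x) + F (((t : ℝ) / r) • y) := by
    intro x hx y hy hsx hty hxy hz
    rw [jensen x hx y hy hxy hz, homs x hx hsx, homt y hy hty]
  obtain ⟨δ, hδ, hδB'⟩ := Metric.isOpen_iff.1 hopen 0 h0
  have hδB : ∀ x, ‖x‖ < δ → x ∈ B := fun x hx => hδB' (by simpa using hx)
  have ha : 0 < (s : ℝ) / r := by positivity
  have hb : 0 < (t : ℝ) / r := by positivity
  -- Vectors shorter than `ρ` stay in the `δ`-ball after division by s/r or t/r.
  obtain ⟨ρ, hρ, hρδ, hρa, hρb⟩ : ∃ ρ : ℝ, 0 < ρ ∧ ρ ≤ δ ∧ ρ ≤ δ * ((s : ℝ) / r) ∧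
      ρ ≤ δ * ((t : ℝ) / r) :=
    ⟨min δ (min (δ * ((s : ℝ) / r)) (δ * ((t : ℝ) / r))),
      lt_min hδ (lt_min (by positivity) (by positivity)), min_le_left _ _,
      (min_le_right _ _).trans (min_le_left _ _), (min_le_right _ _).trans (min_le_right _ _)⟩
  have hρB : ∀ x, ‖x‖ < ρ → x ∈ B := fun x hx => hδB x (hx.trans_le hρδ)
  have inv_mem : ∀ k : ℝ, 0 < k → ρ ≤ δ * k → ∀ x : X, ‖x‖ < ρ → k⁻¹ • x ∈ B := by
    intro k hk hkρ x hx
    refine hδB _ ?_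
    rw [norm_smul, Real.norm_of_nonneg (by positivity), inv_mul_lt_iff₀ hk, mul_comm]
    exact hx.trans_le hkρ
  have local_add : IsOrthogonallyAdditiveBelow ρ F := by
    intro x y hxy hn
    have hx : ‖x‖ < ρ := (norm_le_norm_add_of_inner_eq_zero hxy).trans_lt hn
    have hy : ‖y‖ < ρ := by
      rw [add_comm] at hn
      exact (norm_le_norm_add_of_inner_eq_zero (by rw [real_inner_comm, hxy])).trans_lt hn
    have e := additive _ (inv_mem _ ha hρa x hx) _ (inv_mem _ hb hρb y hy)
    rw [smul_inv_smul₀ ha.ne', smul_inv_smul₀ hb.ne'] at e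
    exact e (hρB x hx) (hρB y hy)
      (by rw [real_inner_smul_left, real_inner_smul_right, hxy, mul_zero, mul_zero]) (hρB _ hn)
  obtain ⟨T, b, hTb⟩ := local_add.exists_addMonoidHom hdim hρ
  by_cases hsr : s = r
  · by_cases htr : t = r
    · refine ⟨T, b, fun x => ?_⟩
      rw [hsr, htr, div_self hr'.ne'] at additive
      simp only [one_smul] at additive
      have h := eq_zero_of_orthogonallyAdditive hdim hopen hconv hρ hρB
        (G := fun x => F x - (T x + b (‖x‖₊ ^ 2))) ?_ (fun x hx => sub_eq_zero.2 (hTb x hx)) x x.2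
      · rw [← hFf]; exact sub_eq_zero.1 h
      · intro x hx y hy hxy hz
        have hq : ‖x + y‖₊ ^ 2 = ‖x‖₊ ^ 2 + ‖y‖₊ ^ 2 :=
          NNReal.coe_injective (by push_cast; exact norm_add_sq_of_inner_eq_zero hxy)
        simp only [additive x hx y hy hx hy hxy hz, hq, map_add]
        abel
    · refine ⟨T, 0, fun x => ?_⟩
      rw [← hFf, eq_addMonoidHom_of_homogeneous hconv hρ hρB hTb ht hr htr homt x x.2]
      simp
  · refine ⟨T, 0, fun x => ?_⟩
    rw [← hFf, eq_addMonoidHom_of_homogeneous hconv hρ hρB hTb hs hr hsr homs x x.2]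
    simp
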